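/- **Categories with subobjects and normal categories.** Composition is written from left to right. A small category $\mathcal C$ with a distinguished wide subcategory of morphisms, called inclusions, is a category with subobjects if there is at most one inclusion between any two objects, inclusions $a\to b$ and $b\to a$ exist together only if $a=b$, inclusions are monomorphisms, and $h$ is an inclusion whenever $hg$ and $g$ are inclusions. A retraction is a right inverse $q$ of an inclusion $j$ ($jq=1$). A normal factorization of $f$ is $f=quj$ with $q$ a retraction, $u$ an isomorphism and $j$ an inclusion; then $f^\circ=qu$ is the epimorphic component of $f$ (it is independent of the factorization). A normal cone $\gamma$ with apex $c_\gamma$ is a family of morphisms $\gamma(a):a\to c_\gamma$ ($a\in\mathcal C$) such that $j\,\gamma(b)=\gamma(a)$ for every inclusion $j:a\to b$ and some $\gamma(m)$ is an isomorphism. $\mathcal C$ is a normal category if every inclusion splits, every morphism has a normal factorization, and every object $c$ is the apex of a normal cone $\gamma$ with $\gamma(c)=1_c$. An isomorphism of normal categories is an isomorphism of categories which, together with its inverse, preserves inclusions. **Normal dual.** For a normal cone $\gamma$ and an epimorphism $f:c_\gamma\to d$ let $\gamma*f$ be the normal cone $a\mapsto\gamma(a)f$ with apex $d$. Normal cones are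 multiplied by $\gamma\cdot\delta=\gamma*(\delta(c_\gamma))^\circ$. For a normal cone $\gamma$ let $H(\gamma;-)$ be the set-valued functor on $\mathcal C$ with $H(\gamma;c)=\{\gamma*f^\circ : f\in\mathcal C(c_\gamma,c)\}$ and $H(\gamma;g):\gamma*f^\circ\mapsto\gamma*(fg)^\circ$. The normal dual $N^*\mathcal C$ is the category whose objects are the functors $H(\varepsilon;-)$ with $\varepsilon$ an idempotent normal cone and whose morphisms are all natural transformations between them; its inclusions are the natural transformations all of whose components are inclusion maps of sets. **Ideal categories.** Let $S$ be a regular semigroup. The category $\mathbb L(S)$ has as objects the principal left ideals $Se$, $e\in S$ idempotent, and as morphisms $Se\to Sf$ the maps $x\mapsto xu$ with $u\in eSf$. The category $\mathbb R(S)$ has as objects the principal right ideals $eS$, $e$ idempotent, and as morphisms $eS\to fS$ the maps $x\mapsto ux$ with $u\in fSe$. With the set-theoretic inclusion maps as inclusions, both are normal categories. **Theorem.** Let $S$ be a Clifford semigroup, that is, a semilattice of groups. Then the normal dual $N^*\mathbb L(S)$ of the normal category $\mathbb L(S)$ is a normal category, and it is isomorphic, as a normal category, to $\mathbb R(S)$.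 -/

import Mathlib

open CategoryTheory

universe v u

namespace CrossConnection

/-! ### Categories with subobjects and normal categories -/

/-- A category with subobjects: a category with a distinguished wide subcategory of morphisms,
the inclusions, which is a strict preorder (there is at most one inclusion between two objects,
and inclusions in both directions force the objects to be equal), which consists of
monomorphisms, and such that `h` is an inclusion whenever `h ≫ g` and `g` are inclusions. -/
class CategoryWithSubobjects (C : Type u) [Category.{v} C] where
  inclusion : MorphismProperty C
  id_inclusion : ∀ a : C, inclusion (𝟙 a)
  comp_inclusion : ∀ {a b c : C} (f : a ⟶ b) (g : b ⟶ c),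
    inclusion f → inclusion g → inclusion (f ≫ g)
  inclusion_unique : ∀ {a b : C} (f g : a ⟶ b), inclusion f → inclusion g → f = g
  inclusion_antisymm : ∀ {a b : C} (f : a ⟶ b) (g : b ⟶ a), inclusion f → inclusion g → a = b
  mono_of_inclusion : ∀ {a b : C} (f : a ⟶ b), inclusion f → Mono f
  inclusion_of_comp : ∀ {a b c : C} (h : a ⟶ b) (g : b ⟶ c),
    inclusion (h ≫ g) → inclusion g → inclusion h

open CategoryWithSubobjects

section General

variable {C : Type u} [Category.{v} C] [CategoryWithSubobjects C]

/-- A retraction is a right inverse (in diagrammatic order) of an inclusion. -/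
def IsRetraction {a b : C} (q : a ⟶ b) : Prop :=
  ∃ j : b ⟶ a, inclusion j ∧ j ≫ q = 𝟙 b

/-- A normal factorization `f = q u j` of a morphism: `q` is a retraction, `u` is an isomorphism
and `j` is an inclusion. -/
structure NormalFactorization {a b : C} (f : a ⟶ b) where
  mid : C
  im : C
  q : a ⟶ mid
  u : mid ⟶ im
  j : im ⟶ b
  isRetraction : IsRetraction q
  isIso : IsIso u
  isInclusion : inclusion j
  fac : f = q ≫ u ≫ j

variable (C) in
/-- A normal cone: a family of morphisms from all objects to a fixed apex, compatible with
inclusions, at least one component of which is an isomorphism. -/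
@[ext]
structure NormalCone where
  apex : C
  component : ∀ a : C, a ⟶ apex
  comp_component : ∀ {a b : C} (j : a ⟶ b), inclusion j → j ≫ component b = component a
  exists_isIso : ∃ m : C, IsIso (component m)

variable (C) in
/-- A normal category: a category with subobjects in which every inclusion splits, every morphism
has a normal factorization, and every object `c` is the apex of a normal cone whose component at
`c` is the identity. -/
class IsNormalCategory : Prop where
  inclusion_splits : ∀ {a b : C} (j : a ⟶ b), inclusion j → ∃ q : b ⟶ a, j ≫ q = 𝟙 a
  exists_factorization : ∀ {a b : C} (f : a ⟶ b), Nonempty (NormalFactorization f)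
  exists_cone : ∀ c : C, ∃ γ : NormalCone C, γ.apex = c ∧ γ.component γ.apex = 𝟙 γ.apex

variable [IsNormalCategory C]

/-- A normal factorization of `f`. The image `im` and the epimorphic component `q ≫ u` do not
depend on the choice, see `NormalFactorization.im_eq` and `NormalFactorization.epi_heq`. -/
noncomputable def factorization {a b : C} (f : a ⟶ b) : NormalFactorization f :=
  (IsNormalCategory.exists_factorization f).some

/-- The image of a morphism. -/
noncomputable abbrev image {a b : C} (f : a ⟶ b) : C := (factorization f).im

/-- The epimorphic component `f° = q u` of a morphism `f` with normal factorization `f = q u j`. -/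
noncomputable def epiPart {a b : C} (f : a ⟶ b) : a ⟶ image f :=
  (factorization f).q ≫ (factorization f).u

/-- The inclusion of the image of `f` in the codomain of `f`. -/
noncomputable def imageInclusion {a b : C} (f : a ⟶ b) : image f ⟶ b := (factorization f).j

theorem epiPart_comp {a b : C} (f : a ⟶ b) : epiPart f ≫ imageInclusion f = f := by
  exact (Category.assoc _ _ _).trans (factorization f).fac.symm

theorem imageInclusion_inclusion {a b : C} (f : a ⟶ b) : inclusion (imageInclusion f) :=
  (factorization f).isInclusion

end General

section Lemmas

variable {C : Type u} [Category.{v} C] [CategoryWithSubobjects C]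

theorem IsRetraction.epi {a b : C} {q : a ⟶ b} (hq : IsRetraction q) : Epi q := by
  obtain ⟨j, -, h⟩ := hq
  exact ⟨fun g k hgk => by
    rw [← Category.id_comp g, ← Category.id_comp k, ← h, Category.assoc, Category.assoc, hgk]⟩

/-- The image of a morphism does not depend on the normal factorization. -/
theorem NormalFactorization.im_eq {a b : C} {f : a ⟶ b} (F G : NormalFactorization f) :
    F.im = G.im := by
  have key : ∀ F G : NormalFactorization f, ∃ i : F.im ⟶ G.im, inclusion i := by
    intro F G
    obtain ⟨k, -, hk⟩ := F.isRetraction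
    have := F.isIso
    refine ⟨inv F.u ≫ k ≫ G.q ≫ G.u, inclusion_of_comp _ G.j ?_ G.isInclusion⟩
    have h : (inv F.u ≫ k ≫ G.q ≫ G.u) ≫ G.j = F.j := by
      have h1 : (inv F.u ≫ k ≫ G.q ≫ G.u) ≫ G.j = inv F.u ≫ k ≫ f := by
        simp only [Category.assoc]
        exact congrArg (fun t => inv F.u ≫ k ≫ t) G.fac.symm
      have h2 : inv F.u ≫ k ≫ f = inv F.u ≫ k ≫ F.q ≫ F.u ≫ F.j :=
        congrArg (fun t => inv F.u ≫ k ≫ t) F.fac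
      rw [h1, h2, reassoc_of% hk]
      simp
    rw [h]
    exact F.isInclusion
  obtain ⟨i, hi⟩ := key F G
  obtain ⟨j, hj⟩ := key G F
  exact inclusion_antisymm i j hi hj

/-- The epimorphic component of a morphism does not depend on the normal factorization. -/
theorem NormalFactorization.epi_heq {a b : C} {f : a ⟶ b} (F G : NormalFactorization f) :
    HEq (F.q ≫ F.u) (G.q ≫ G.u) := by
  have h := F.im_eq G
  obtain ⟨m, i, q, u, j, hq, hu, hj, hf⟩ := F
  obtain ⟨m', i', q', u', j', hq', hu', hj', hf'⟩ := G
  dsimp only at h ⊢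
  subst h
  obtain rfl := inclusion_unique j j' hj hj'
  have := mono_of_inclusion j hj
  apply heq_of_eq
  rw [← cancel_mono j, Category.assoc, Category.assoc, ← hf, ← hf']

variable [IsNormalCategory C]

instance epiPart_epi {a b : C} (f : a ⟶ b) : Epi (epiPart f) := by
  have := (factorization f).isRetraction.epi
  have : IsIso (factorization f).u := (factorization f).isIso
  exact epi_comp (factorization f).q (factorization f).u

/-! ### The semigroup of normal cones -/

theorem exists_isIso_comp (γ : NormalCone C) {d : C} (f : γ.apex ⟶ d) [Epi f] :
    ∃ m : C, IsIso (γ.component m ≫ f) := by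
  obtain ⟨m, hm⟩ := γ.exists_isIso
  obtain ⟨c', d', q, u, j, ⟨i, hi, hiq⟩, hu, hj, hf⟩ := factorization f
  -- `f` is an epimorphism, hence `j` is an isomorphism
  obtain ⟨r, hr⟩ := IsNormalCategory.inclusion_splits j hj
  have hje : Epi j := by
    have : Epi (q ≫ u ≫ j) := hf ▸ inferInstance
    have : Epi (u ≫ j) := epi_of_epi q (u ≫ j)
    exact epi_of_epi u j
  have hrj : r ≫ j = 𝟙 d := by
    rw [← cancel_epi j, reassoc_of% hr]; simp
  have hji : IsIso j := ⟨r, hr, hrj⟩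
  -- factorize the monomorphism `i ≫ (γ m)⁻¹`
  have hg : Mono (i ≫ inv (γ.component m)) := by
    have := mono_of_inclusion i hi
    infer_instance
  obtain ⟨c'', m', q', u', j', ⟨i', hi', hiq'⟩, hu', hj', hg'⟩ :=
    factorization (i ≫ inv (γ.component m))
  have hq'm : Mono q' := by
    have : Mono (q' ≫ u' ≫ j') := hg' ▸ hg
    exact mono_of_mono q' (u' ≫ j')
  have hqi : q' ≫ i' = 𝟙 c' := by
    rw [← cancel_mono q', Category.assoc, hiq']; simp
  have hq'i : IsIso q' := ⟨i', hqi, hiq'⟩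
  have hj'' : j' = inv (q' ≫ u') ≫ i ≫ inv (γ.component m) := by
    rw [hg']; simp
  refine ⟨m', ?_⟩
  have : γ.component m' ≫ f = inv (q' ≫ u') ≫ u ≫ j := by
    rw [← γ.comp_component j' hj', hj'', hf]
    simp [reassoc_of% hiq]
  rw [this]
  infer_instance

/-- The normal cone `γ * f`, for an epimorphism `f` from the apex of `γ`: its component at `a` is
`γ(a) f`. -/
def NormalCone.star (γ : NormalCone C) {d : C} (f : γ.apex ⟶ d) [Epi f] : NormalCone C where
  apex := d
  component a := γ.component a ≫ f
  comp_component j hj := by rw [← Category.assoc, γ.comp_component j hj]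
  exists_isIso := exists_isIso_comp γ f

/-- The multiplication of normal cones: `γ δ = γ * (δ(c_γ))°`, where `c_γ` is the apex of `γ`. -/
noncomputable instance : Mul (NormalCone C) where
  mul γ δ := γ.star (epiPart (δ.component γ.apex))

/-! ### The normal dual -/

/-- The morphism `f` can be recovered from the normal cone `γ * f°`. -/
theorem star_epiPart_injective (γ : NormalCone C) {c : C} {f g : γ.apex ⟶ c}
    (h : γ.star (epiPart f) = γ.star (epiPart g)) : f = g := by
  obtain ⟨m, hm⟩ := γ.exists_isIso
  have key : ∀ {d d' : C} (p : γ.apex ⟶ d) (p' : γ.apex ⟶ d') [Epi p] [Epi p'] (j : d ⟶ c)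
      (j' : d' ⟶ c), inclusion j → inclusion j' → γ.star p = γ.star p' → p ≫ j = p' ≫ j' := by
    intro d d' p p' _ _ j j' hj hj' e
    have hd : d = d' := congrArg NormalCone.apex e
    subst hd
    obtain rfl := inclusion_unique j j' hj hj'
    have e2 : γ.component m ≫ p = γ.component m ≫ p' := by
      have e3 := (NormalCone.mk.inj e).2
      exact congrFun (eq_of_heq e3) m
    rw [cancel_epi] at e2
    rw [e2]
  have := key (epiPart f) (epiPart g) _ _ (imageInclusion_inclusion f)
    (imageInclusion_inclusion g) h
  rwa [epiPart_comp, epiPart_comp] at this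

end Lemmas

/-- The objects of the category of sets that are subsets of `X`. -/
structure SubsetOf (X : Type u) where
  carrier : Set X

/-- The category of all subsets of `X`, with all maps between them as morphisms: the full
subcategory of the category of sets on the subsets of `X`. -/
instance (X : Type u) : Category (SubsetOf X) where
  Hom A B := A.carrier → B.carrier
  id _ := fun x => x
  comp f g := fun x => g (f x)

section Dual

variable {C : Type u} [Category.{v} C] [CategoryWithSubobjects C] [IsNormalCategory C]

/-- The set `H(γ; c) = {γ * f° : f ∈ C(c_γ, c)}` of normal cones. -/
def hSet (γ : NormalCone C) (c : C) : Set (NormalCone C) :=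
  {δ | ∃ f : γ.apex ⟶ c, δ = γ.star (epiPart f)}

/-- The map `H(γ; g) : H(γ; c) → H(γ; d)`, which sends `γ * f°` to `γ * (f g)°`
(see `hMap_star`). -/
noncomputable def hMap (γ : NormalCone C) {c d : C} (g : c ⟶ d) (δ : hSet γ c) : hSet γ d :=
  ⟨γ.star (epiPart (δ.2.choose ≫ g)), δ.2.choose ≫ g, rfl⟩

theorem hMap_star (γ : NormalCone C) {c d : C} (g : c ⟶ d) (f : γ.apex ⟶ c) :
    hMap γ g ⟨γ.star (epiPart f), f, rfl⟩ = ⟨γ.star (epiPart (f ≫ g)), f ≫ g, rfl⟩ := by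
  have h : ∃ f' : γ.apex ⟶ c, γ.star (epiPart f) = γ.star (epiPart f') := ⟨f, rfl⟩
  have e : f = h.choose := star_epiPart_injective γ h.choose_spec
  apply Subtype.ext
  change γ.star (epiPart (h.choose ≫ g)) = γ.star (epiPart (f ≫ g))
  rw [← e]

/-- The set-valued functor `H(γ; -)`. Its values are sets of normal cones, so it is regarded as a
functor to the category of all subsets of the set of normal cones. -/
noncomputable def hFunctor (γ : NormalCone C) : C ⥤ SubsetOf (NormalCone C) where
  obj c := ⟨hSet γ c⟩
  map g := hMap γ g
  map_id c := by
    funext ⟨δ, f, hf⟩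
    subst hf
    rw [hMap_star]
    apply Subtype.ext
    change γ.star (epiPart (f ≫ 𝟙 c)) = γ.star (epiPart f)
    rw [Category.comp_id]
  map_comp g h := by
    funext ⟨δ, f, hf⟩
    subst hf
    change _ = hMap γ h (hMap γ g _)
    rw [hMap_star, hMap_star, hMap_star]
    apply Subtype.ext
    change γ.star (epiPart (f ≫ g ≫ h)) = γ.star (epiPart ((f ≫ g) ≫ h))
    rw [Category.assoc]

variable (C) in
/-- The property of being one of the functors `H(ε; -)`, with `ε` an idempotent normal cone. -/
def isDualObject : ObjectProperty (C ⥤ SubsetOf (NormalCone C)) :=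
  fun F => ∃ ε : NormalCone C, ε * ε = ε ∧ F = hFunctor ε

variable (C) in
/-- The normal dual `N*C` of a normal category `C`: the full subcategory of the category of
set-valued functors on `C` whose objects are the functors `H(ε; -)`, with `ε` an idempotent normal
cone; its morphisms are all natural transformations. -/
abbrev NormalDual := (isDualObject C).FullSubcategory

/-- A natural transformation between objects of the normal dual is an inclusion if each of its
components is the inclusion map of a subset. -/
instance : CategoryWithSubobjects (NormalDual C) where
  inclusion F G τ := ∀ (c : C) (x : (F.obj.obj c).carrier),
    ((τ.hom.app c x : (G.obj.obj c).carrier) : NormalCone C) = x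
  id_inclusion _ _ _ := rfl
  comp_inclusion f g hf hg c x := (hg c (f.hom.app c x)).trans (hf c x)
  inclusion_unique f g hf hg := by
    apply ObjectProperty.hom_ext
    ext c
    funext x
    exact Subtype.ext ((hf c x).trans (hg c x).symm)
  inclusion_antisymm {F G} f g hf hg := by
    have key : ∀ (F G : C ⥤ SubsetOf (NormalCone C)) (f : F ⟶ G) (g : G ⟶ F),
        (∀ c (x : (F.obj c).carrier), (f.app c x : (G.obj c).carrier).1 = x.1) →
        (∀ c (x : (G.obj c).carrier), (g.app c x : (F.obj c).carrier).1 = x.1) → F = G := by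
      intro F G f g hf hg
      have hobj : ∀ c, F.obj c = G.obj c := by
        intro c
        have : (F.obj c).carrier = (G.obj c).carrier := by
          ext y
          constructor
          · intro hy
            have := (f.app c ⟨y, hy⟩ : (G.obj c).carrier).2
            rwa [hf] at this
          · intro hy
            have := (g.app c ⟨y, hy⟩ : (F.obj c).carrier).2
            rwa [hg] at this
        cases hF : F.obj c
        cases hG : G.obj c
        rw [hF, hG] at this
        exact congrArg SubsetOf.mk this
      have heq : ∀ {A B : SubsetOf (NormalCone C)} (h : A = B) (x : A.carrier),
          (eqToHom h x : B.carrier).1 = x.1 := by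
        intro A B h x
        subst h
        rfl
      have happ : ∀ c, f.app c = eqToHom (hobj c) := by
        intro c
        funext x
        exact Subtype.ext ((hf c x).trans (heq _ x).symm)
      refine CategoryTheory.Functor.ext hobj ?_
      intro c d k
      have hn := f.naturality k
      rw [happ, happ] at hn
      rw [← reassoc_of% hn]
      simp
    exact ObjectProperty.FullSubcategory.ext (key F.obj G.obj f.hom g.hom hf hg)
  mono_of_inclusion f hf := by
    refine ⟨fun {Z} g h e => ?_⟩
    apply ObjectProperty.hom_ext
    ext c
    funext x
    apply Subtype.ext
    have e1 : (g ≫ f).hom.app c x = (h ≫ f).hom.app c x := by rw [e]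
    exact (hf c (g.hom.app c x)).symm.trans ((congrArg Subtype.val e1).trans (hf c (h.hom.app c x)))
  inclusion_of_comp h g hhg hg c x := (hg c (h.hom.app c x)).symm.trans (hhg c x)

end Dual

/-- An isomorphism of normal categories: an isomorphism of categories that preserves inclusions,
in both directions. -/
structure NormalCategoryIso (C : Type*) (D : Type*) [Category* C] [Category* D]
    [CategoryWithSubobjects C] [CategoryWithSubobjects D] [IsNormalCategory C]
    [IsNormalCategory D] extends IsoCat C D where
  functor_inclusion : ∀ {a b : C} (j : a ⟶ b), inclusion j → inclusion (functor.map j)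
  inverse_inclusion : ∀ {a b : D} (j : a ⟶ b), inclusion j → inclusion (inverse.map j)

/-! ### Regular and Clifford semigroups -/

/-- A semigroup is regular if each `a` has an `x` with `a x a = a`. -/
class RegularSemigroup (S : Type u) [Semigroup S] : Prop where
  exists_mul_mul_eq : ∀ a : S, ∃ x : S, a * x * a = a

/-- A Clifford semigroup is a semilattice of groups: there is a homomorphism `π` onto a
(meet-)semilattice `Y` each of whose fibres is a group. -/
class CliffordSemigroup (S : Type u) [Semigroup S] : Prop where
  semilattice_of_groups : ∃ (Y : Type u) (_ : SemilatticeInf Y) (π : S → Y),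
    Function.Surjective π ∧ (∀ x y : S, π (x * y) = π x ⊓ π y) ∧
    ∀ α : Y, ∃ e : S, π e = α ∧
      (∀ x, π x = α → e * x = x ∧ x * e = x) ∧
      (∀ x, π x = α → ∃ y, π y = α ∧ x * y = e ∧ y * x = e)

instance (S : Type u) [Semigroup S] [CliffordSemigroup S] : RegularSemigroup S where
  exists_mul_mul_eq a := by
    obtain ⟨Y, _, π, -, -, h⟩ := CliffordSemigroup.semilattice_of_groups (S := S)
    obtain ⟨e, -, h1, h2⟩ := h (π a)
    obtain ⟨y, -, hy, -⟩ := h2 a rfl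
    exact ⟨y, by rw [hy, (h1 a rfl).1]⟩

section Ideals

variable (S : Type u) [Semigroup S]

/-- The principal left ideal `Se`. -/
def leftIdeal {S : Type u} [Semigroup S] (e : S) : Set S := {x | ∃ s, x = s * e}

/-- The principal right ideal `eS`. -/
def rightIdeal {S : Type u} [Semigroup S] (e : S) : Set S := {x | ∃ s, x = e * s}

/-- The objects of `𝕃(S)`: the principal left ideals `Se` with `e` idempotent. -/
@[ext]
structure LeftIdealCat where
  carrier : Set S
  exists_idempotent : ∃ e : S, IsIdempotentElem e ∧ carrier = leftIdeal e

/-- The objects of `ℝ(S)`: the principal right ideals `eS` with `e` idempotent. -/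
@[ext]
structure RightIdealCat where
  carrier : Set S
  exists_idempotent : ∃ e : S, IsIdempotentElem e ∧ carrier = rightIdeal e

variable {S}

/-- The morphisms of `𝕃(S)`: the maps `ρ(e,u,f) : Se → Sf`, `x ↦ x u`, with `u ∈ eSf`. -/
@[ext]
structure LeftIdealCat.Hom (A B : LeftIdealCat S) where
  toFun : A.carrier → B.carrier
  exists_rho : ∃ e u f : S, IsIdempotentElem e ∧ IsIdempotentElem f ∧
    A.carrier = leftIdeal e ∧ B.carrier = leftIdeal f ∧ (∃ s, u = e * s * f) ∧
    ∀ x, (toFun x : S) = x * u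

/-- The morphisms of `ℝ(S)`: the maps `λ(e,u,f) : eS → fS`, `x ↦ u x`, with `u ∈ fSe`. -/
@[ext]
structure RightIdealCat.Hom (A B : RightIdealCat S) where
  toFun : A.carrier → B.carrier
  exists_lambda : ∃ e u f : S, IsIdempotentElem e ∧ IsIdempotentElem f ∧
    A.carrier = rightIdeal e ∧ B.carrier = rightIdeal f ∧ (∃ s, u = f * s * e) ∧
    ∀ x, (toFun x : S) = u * x

theorem mem_leftIdeal {e x : S} (he : IsIdempotentElem e) : x ∈ leftIdeal e ↔ x * e = x := by
  constructor
  · rintro ⟨s, rfl⟩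
    rw [mul_assoc, he.eq]
  · intro h
    exact ⟨x, h.symm⟩

theorem mem_rightIdeal {e x : S} (he : IsIdempotentElem e) : x ∈ rightIdeal e ↔ e * x = x := by
  constructor
  · rintro ⟨s, rfl⟩
    rw [← mul_assoc, he.eq]
  · intro h
    exact ⟨x, h.symm⟩

theorem mul_mul_eq_of_mem {e u f : S} (he : IsIdempotentElem e) (hf : IsIdempotentElem f)
    (hu : ∃ s, u = e * s * f) : e * u = u ∧ u * f = u := by
  obtain ⟨s, rfl⟩ := hu
  constructor
  · rw [← mul_assoc, ← mul_assoc, he.eq]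
  · rw [mul_assoc, hf.eq]

instance : Category (LeftIdealCat S) where
  Hom := LeftIdealCat.Hom
  id A := ⟨fun x => x, by
    obtain ⟨e, he, hA⟩ := A.exists_idempotent
    refine ⟨e, e, e, he, he, hA, hA, ⟨e, by rw [he.eq, he.eq]⟩, fun x => ?_⟩
    exact ((mem_leftIdeal he).1 (hA.subset x.2)).symm⟩
  comp {A B D} φ ψ := ⟨fun x => ψ.toFun (φ.toFun x), by
    obtain ⟨e, u, f, he, hf, hA, hB, ⟨s, hs⟩, hφ⟩ := φ.exists_rho
    obtain ⟨g, v, h, hg, hh, hB', hD, ⟨t, ht⟩, hψ⟩ := ψ.exists_rho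
    refine ⟨e, u * v, h, he, hh, hA, hD, ⟨s * f * g * t, ?_⟩, fun x => ?_⟩
    · rw [hs, ht]; simp only [mul_assoc]
    · rw [hψ, hφ, mul_assoc]⟩

instance : Category (RightIdealCat S) where
  Hom := RightIdealCat.Hom
  id A := ⟨fun x => x, by
    obtain ⟨e, he, hA⟩ := A.exists_idempotent
    refine ⟨e, e, e, he, he, hA, hA, ⟨e, by rw [he.eq, he.eq]⟩, fun x => ?_⟩
    exact ((mem_rightIdeal he).1 (hA.subset x.2)).symm⟩
  comp {A B D} φ ψ := ⟨fun x => ψ.toFun (φ.toFun x), by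
    obtain ⟨e, u, f, he, hf, hA, hB, ⟨s, hs⟩, hφ⟩ := φ.exists_lambda
    obtain ⟨g, v, h, hg, hh, hB', hD, ⟨t, ht⟩, hψ⟩ := ψ.exists_lambda
    refine ⟨e, v * u, h, he, hh, hA, hD, ⟨t * g * f * s, ?_⟩, fun x => ?_⟩
    · rw [hs, ht]; simp only [mul_assoc]
    · rw [hψ, hφ, mul_assoc]⟩

theorem LeftIdealCat.hom_ext {A B : LeftIdealCat S} {φ ψ : A ⟶ B}
    (h : ∀ x, (φ.toFun x : S) = ψ.toFun x) : φ = ψ :=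
  LeftIdealCat.Hom.ext (funext fun x => Subtype.ext (h x))

theorem RightIdealCat.hom_ext {A B : RightIdealCat S} {φ ψ : A ⟶ B}
    (h : ∀ x, (φ.toFun x : S) = ψ.toFun x) : φ = ψ :=
  RightIdealCat.Hom.ext (funext fun x => Subtype.ext (h x))

/-- The inclusions of `𝕃(S)` are the inclusion maps of principal left ideals. -/
instance : CategoryWithSubobjects (LeftIdealCat S) where
  inclusion _ _ φ := ∀ x, (φ.toFun x : S) = x
  id_inclusion _ _ := rfl
  comp_inclusion f g hf hg x := (hg (f.toFun x)).trans (hf x)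
  inclusion_unique f g hf hg := LeftIdealCat.hom_ext fun x => (hf x).trans (hg x).symm
  inclusion_antisymm f g hf hg := by
    ext x
    constructor
    · intro hx
      have := (f.toFun ⟨x, hx⟩).2
      rwa [hf] at this
    · intro hx
      have := (g.toFun ⟨x, hx⟩).2
      rwa [hg] at this
  mono_of_inclusion f hf := ⟨fun g h e => LeftIdealCat.hom_ext fun x => by
    have e1 : (g ≫ f).toFun x = (h ≫ f).toFun x := by rw [e]
    exact (hf (g.toFun x)).symm.trans ((congrArg Subtype.val e1).trans (hf (h.toFun x)))⟩
  inclusion_of_comp h g hhg hg x := (hg (h.toFun x)).symm.trans (hhg x)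

/-- The inclusions of `ℝ(S)` are the inclusion maps of principal right ideals. -/
instance : CategoryWithSubobjects (RightIdealCat S) where
  inclusion _ _ φ := ∀ x, (φ.toFun x : S) = x
  id_inclusion _ _ := rfl
  comp_inclusion f g hf hg x := (hg (f.toFun x)).trans (hf x)
  inclusion_unique f g hf hg := RightIdealCat.hom_ext fun x => (hf x).trans (hg x).symm
  inclusion_antisymm f g hf hg := by
    ext x
    constructor
    · intro hx
      have := (f.toFun ⟨x, hx⟩).2
      rwa [hf] at this
    · intro hx
      have := (g.toFun ⟨x, hx⟩).2
      rwa [hg] at this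
  mono_of_inclusion f hf := ⟨fun g h e => RightIdealCat.hom_ext fun x => by
    have e1 : (g ≫ f).toFun x = (h ≫ f).toFun x := by rw [e]
    exact (hf (g.toFun x)).symm.trans ((congrArg Subtype.val e1).trans (hf (h.toFun x)))⟩
  inclusion_of_comp h g hhg hg x := (hg (h.toFun x)).symm.trans (hhg x)

/-- The object `Se` of `𝕃(S)`. -/
def leftObj (e : S) (he : IsIdempotentElem e) : LeftIdealCat S := ⟨leftIdeal e, e, he, rfl⟩

/-- The object `eS` of `ℝ(S)`. -/
def rightObj (e : S) (he : IsIdempotentElem e) : RightIdealCat S := ⟨rightIdeal e, e, he, rfl⟩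

theorem mem_carrier_left {A : LeftIdealCat S} {e : S} (he : IsIdempotentElem e)
    (hA : A.carrier = leftIdeal e) (x : A.carrier) : (x : S) * e = x := by
  exact (mem_leftIdeal he).1 (hA.subset x.2)

theorem mem_carrier_right {A : RightIdealCat S} {e : S} (he : IsIdempotentElem e)
    (hA : A.carrier = rightIdeal e) (x : A.carrier) : e * (x : S) = x := by
  exact (mem_rightIdeal he).1 (hA.subset x.2)

/-- The morphism `ρ(e,u,f) : A ⟶ B`, where `A = Se` and `B = Sf`. -/
def rho {A B : LeftIdealCat S} (e u f : S) (he : IsIdempotentElem e) (hf : IsIdempotentElem f)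
    (hA : A.carrier = leftIdeal e) (hB : B.carrier = leftIdeal f) (hu : ∃ s, u = e * s * f) :
    A ⟶ B :=
  LeftIdealCat.Hom.mk
    (fun x => ⟨x * u, by
      rw [hB, mem_leftIdeal hf, mul_assoc, (mul_mul_eq_of_mem he hf hu).2]⟩)
    ⟨e, u, f, he, hf, hA, hB, hu, fun _ => rfl⟩

/-- The morphism `λ(e,u,f) : A ⟶ B`, where `A = eS` and `B = fS`. -/
def lam {A B : RightIdealCat S} (e u f : S) (he : IsIdempotentElem e) (hf : IsIdempotentElem f)
    (hA : A.carrier = rightIdeal e) (hB : B.carrier = rightIdeal f) (hu : ∃ s, u = f * s * e) :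
    A ⟶ B :=
  RightIdealCat.Hom.mk
    (fun x => ⟨u * x, by
      rw [hB, mem_rightIdeal hf, ← mul_assoc, (mul_mul_eq_of_mem hf he hu).1]⟩)
    ⟨e, u, f, he, hf, hA, hB, hu, fun _ => rfl⟩

/-- In a regular semigroup, an element `u ∈ eSf` has an inverse `v ∈ fSe`. -/
theorem exists_inverse [RegularSemigroup S] {e u f : S} (he : IsIdempotentElem e)
    (hf : IsIdempotentElem f) (hu : ∃ s, u = e * s * f) :
    ∃ v, (∃ s, v = f * s * e) ∧ u * v * u = u ∧ v * u * v = v := by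
  obtain ⟨h1, h2⟩ := mul_mul_eq_of_mem he hf hu
  obtain ⟨x, hx⟩ := RegularSemigroup.exists_mul_mul_eq u
  have hx' : u * (x * u) = u := by rw [← mul_assoc, hx]
  refine ⟨f * (x * u * x) * e, ⟨_, rfl⟩, ?_, ?_⟩
  · calc u * (f * (x * u * x) * e) * u = (u * f) * x * u * x * (e * u) := by
          simp only [mul_assoc]
      _ = u := by rw [h1, h2, hx, hx]
  · calc f * (x * u * x) * e * u * (f * (x * u * x) * e)
        = f * x * (u * x * (e * u) * f * x * u) * x * e := by simp only [mul_assoc]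
      _ = f * x * ((u * x * u) * f * x * u) * x * e := by rw [h1]
      _ = f * (x * u * x) * e := by rw [hx, h2, hx]; simp only [mul_assoc]

/-- The category of principal left ideals of a regular semigroup is a normal category. -/
instance [RegularSemigroup S] : IsNormalCategory (LeftIdealCat S) where
  inclusion_splits {A B} j hj := by
    obtain ⟨e, he, hA⟩ := A.exists_idempotent
    obtain ⟨f, hf, hB⟩ := B.exists_idempotent
    refine ⟨rho f (f * e) e hf he hB hA ⟨e, by rw [mul_assoc, he.eq]⟩,
      LeftIdealCat.hom_ext fun x => ?_⟩
    change (j.toFun x : S) * (f * e) = x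
    rw [← mul_assoc, mem_carrier_left hf hB, hj, mem_carrier_left he hA]
  exists_factorization {A B} φ := by
    obtain ⟨e, u, f, he, hf, hA, hB, hu, hφ⟩ := φ.exists_rho
    obtain ⟨h1, h2⟩ := mul_mul_eq_of_mem he hf hu
    obtain ⟨v, hv, huv, hvu⟩ := exists_inverse he hf hu
    obtain ⟨h3, h4⟩ := mul_mul_eq_of_mem hf he hv
    have hg : IsIdempotentElem (u * v) := by
      rw [IsIdempotentElem, ← mul_assoc, huv]
    have hh : IsIdempotentElem (v * u) := by
      rw [IsIdempotentElem, ← mul_assoc, hvu]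
    have hge : u * v * e = u * v := by rw [mul_assoc, h4]
    have heg : e * (u * v) = u * v := by rw [← mul_assoc, h1]
    have hhf : v * u * f = v * u := by rw [mul_assoc, h2]
    have huu : ∃ s, u = u * v * s * (v * u) :=
      ⟨u, by rw [huv, ← mul_assoc, huv]⟩
    have hvv : ∃ s, v = v * u * s * (u * v) :=
      ⟨v, by rw [hvu, ← mul_assoc, hvu]⟩
    refine ⟨⟨leftObj _ hg, leftObj _ hh,
      rho e (u * v) (u * v) he hg hA rfl ⟨u * v, by rw [heg, hg.eq]⟩,
      rho (u * v) u (v * u) hg hh rfl rfl huu,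
      rho (v * u) (v * u) f hh hf rfl hB ⟨v * u, by rw [hh.eq, hhf]⟩, ?_, ?_, ?_, ?_⟩⟩
    · refine ⟨rho (u * v) (u * v) e hg he rfl hA ⟨u * v, by rw [hg.eq, hge]⟩,
        fun x => mem_carrier_left (A := leftObj _ hg) hg rfl x,
        LeftIdealCat.hom_ext fun x => ?_⟩
      change (x : S) * (u * v) * (u * v) = x
      rw [mem_carrier_left (A := leftObj _ hg) hg rfl x,
        mem_carrier_left (A := leftObj _ hg) hg rfl x]
    · refine ⟨rho (v * u) v (u * v) hh hg rfl rfl hvv, LeftIdealCat.hom_ext fun x => ?_,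
        LeftIdealCat.hom_ext fun x => ?_⟩
      · change (x : S) * u * v = x
        rw [mul_assoc, mem_carrier_left (A := leftObj _ hg) hg rfl x]
      · change (x : S) * v * u = x
        rw [mul_assoc, mem_carrier_left (A := leftObj _ hh) hh rfl x]
    · exact fun x => mem_carrier_left (A := leftObj _ hh) hh rfl x
    · refine LeftIdealCat.hom_ext fun x => ?_
      change (φ.toFun x : S) = x * (u * v) * u * (v * u)
      have : (x : S) * (u * v) * u * (v * u) = x * (u * v * u * v * u) := by
        simp only [mul_assoc]
      rw [this, huv, huv, hφ]
  exists_cone A := by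
    obtain ⟨e, he, hA⟩ := A.exists_idempotent
    have hcone : ∀ x : A.carrier, (x : S) * e = x := mem_carrier_left he hA
    let comp : ∀ B : LeftIdealCat S, B ⟶ A := fun B =>
      LeftIdealCat.Hom.mk (fun x => ⟨x * e, by rw [hA]; exact ⟨x, rfl⟩⟩) (by
        obtain ⟨f, hf, hB⟩ := B.exists_idempotent
        refine ⟨f, f * e, e, hf, he, hB, hA, ⟨e, by rw [mul_assoc, he.eq]⟩, fun x => ?_⟩
        change (x : S) * e = x * (f * e)
        rw [← mul_assoc, mem_carrier_left hf hB])
    have hid : comp A = 𝟙 A := LeftIdealCat.hom_ext hcone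
    refine ⟨⟨A, comp, ?_, A, ?_⟩, rfl, hid⟩
    · intro B D j hj
      refine LeftIdealCat.hom_ext fun x => ?_
      change (j.toFun x : S) * e = x * e
      rw [hj]
    · rw [hid]; infer_instance

/-- The category of principal right ideals of a regular semigroup is a normal category. -/
instance [RegularSemigroup S] : IsNormalCategory (RightIdealCat S) where
  inclusion_splits {A B} j hj := by
    obtain ⟨e, he, hA⟩ := A.exists_idempotent
    obtain ⟨f, hf, hB⟩ := B.exists_idempotent
    refine ⟨lam f (e * f) e hf he hB hA ⟨e, by rw [he.eq]⟩,
      RightIdealCat.hom_ext fun x => ?_⟩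
    change (e * f) * (j.toFun x : S) = x
    rw [mul_assoc, mem_carrier_right hf hB, hj, mem_carrier_right he hA]
  exists_factorization {A B} φ := by
    obtain ⟨e, u, f, he, hf, hA, hB, hu, hφ⟩ := φ.exists_lambda
    obtain ⟨h1, h2⟩ := mul_mul_eq_of_mem hf he hu
    obtain ⟨v, hv, huv, hvu⟩ := exists_inverse hf he hu
    obtain ⟨h3, h4⟩ := mul_mul_eq_of_mem he hf hv
    have hg : IsIdempotentElem (v * u) := by
      rw [IsIdempotentElem, ← mul_assoc, hvu]
    have hh : IsIdempotentElem (u * v) := by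
      rw [IsIdempotentElem, ← mul_assoc, huv]
    have hge : v * u * e = v * u := by rw [mul_assoc, h2]
    have heg : e * (v * u) = v * u := by rw [← mul_assoc, h3]
    have hfh : f * (u * v) = u * v := by rw [← mul_assoc, h1]
    have huu : ∃ s, u = u * v * s * (v * u) :=
      ⟨u, by rw [huv, ← mul_assoc, huv]⟩
    have hvv : ∃ s, v = v * u * s * (u * v) :=
      ⟨v, by rw [hvu, ← mul_assoc, hvu]⟩
    refine ⟨⟨rightObj _ hg, rightObj _ hh,
      lam e (v * u) (v * u) he hg hA rfl ⟨v * u, by rw [hg.eq, hge]⟩,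
      lam (v * u) u (u * v) hg hh rfl rfl huu,
      lam (u * v) (u * v) f hh hf rfl hB ⟨u * v, by rw [hfh, hh.eq]⟩, ?_, ?_, ?_, ?_⟩⟩
    · refine ⟨lam (v * u) (v * u) e hg he rfl hA ⟨v * u, by rw [heg, hg.eq]⟩,
        fun x => mem_carrier_right (A := rightObj _ hg) hg rfl x,
        RightIdealCat.hom_ext fun x => ?_⟩
      change (v * u) * ((v * u) * (x : S)) = x
      rw [mem_carrier_right (A := rightObj _ hg) hg rfl x,
        mem_carrier_right (A := rightObj _ hg) hg rfl x]
    · refine ⟨lam (u * v) v (v * u) hh hg rfl rfl hvv, RightIdealCat.hom_ext fun x => ?_,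
        RightIdealCat.hom_ext fun x => ?_⟩
      · change v * (u * (x : S)) = x
        rw [← mul_assoc, mem_carrier_right (A := rightObj _ hg) hg rfl x]
      · change u * (v * (x : S)) = x
        rw [← mul_assoc, mem_carrier_right (A := rightObj _ hh) hh rfl x]
    · exact fun x => mem_carrier_right (A := rightObj _ hh) hh rfl x
    · refine RightIdealCat.hom_ext fun x => ?_
      change (φ.toFun x : S) = (u * v) * (u * ((v * u) * x))
      have : (u * v) * (u * ((v * u) * (x : S))) = (u * v * u * v * u) * x := by
        simp only [mul_assoc]
      rw [this, huv, huv, hφ]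
  exists_cone A := by
    obtain ⟨e, he, hA⟩ := A.exists_idempotent
    have hcone : ∀ x : A.carrier, e * (x : S) = x := mem_carrier_right he hA
    let comp : ∀ B : RightIdealCat S, B ⟶ A := fun B =>
      RightIdealCat.Hom.mk (fun x => ⟨e * x, by rw [hA]; exact ⟨x, rfl⟩⟩) (by
        obtain ⟨f, hf, hB⟩ := B.exists_idempotent
        refine ⟨f, e * f, e, hf, he, hB, hA, ⟨e, by rw [he.eq]⟩, fun x => ?_⟩
        change e * (x : S) = (e * f) * x
        rw [mul_assoc, mem_carrier_right hf hB])
    have hid : comp A = 𝟙 A := RightIdealCat.hom_ext hcone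
    refine ⟨⟨A, comp, ?_, A, ?_⟩, rfl, hid⟩
    · intro B D j hj
      refine RightIdealCat.hom_ext fun x => ?_
      change e * (j.toFun x : S) = e * x
      rw [hj]
    · rw [hid]; infer_instance

end Ideals

end CrossConnection

/-!
The idempotents of a Clifford semigroup `S` are central (`idempotent_mul_comm`). Hence a morphism
of `𝕃(S)` maps its domain into itself (`LeftIdealCat.Hom.toFun_mem_domain`), isomorphisms of `𝕃(S)`
exist only between equal objects, and a normal cone `γ` is determined by its component at its apex:
every normal cone is one of the principal cones `ρ^x`, all of whose components are right
multiplication by `x`, for exactly one `x ∈ S` (`principalCone_surjective`,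
`principalCone_injective`).

Under the bijection `x ↦ ρ^x` multiplication of cones becomes multiplication in `S`
(`principalCone_mul`), the idempotent cones are the `ρ^e` with `e` idempotent, and `H(ρ^e; Sc)`
becomes `eS ∩ Sc`, on which a morphism `g` of `𝕃(S)` acts as `u ↦ ug` (`mem_hSet_principalCone`,
`hMap_principalCone`). A morphism `eS ⟶ fS` of `ℝ(S)` is a left multiplication; it therefore maps
`eS ∩ Sc` to `fS ∩ Sc` naturally in `c`, and by the Yoneda argument all natural transformations
`H(ρ^e; -) ⟶ H(ρ^f; -)` arise in this way. So `eS ↦ H(ρ^e; -)` is a functor `dualFunctor` from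
`ℝ(S)` to `N*𝕃(S)` that is fully faithful, bijective on objects, and preserves and reflects
inclusions. Normality of the dual is transported from `ℝ(S)` along it.
-/

open CategoryTheory

namespace CrossConnection

open CategoryWithSubobjects

/-! ### Transport of normality along an isomorphism of categories -/

section Transport

variable {C : Type*} {D : Type*} [Category* C] [Category* D]
  [CategoryWithSubobjects C] [CategoryWithSubobjects D]

theorem inclusion_eqToHom {a b : C} (h : a = b) : inclusion (eqToHom h) := by
  subst h
  exact id_inclusion a

/-- Normality is transported along a functor that is an isomorphism of categories and preserves and
reflects inclusions. -/
theorem IsNormalCategory.of_isIso (F : D ⥤ C) [F.IsIso] [IsNormalCategory D]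
    (hF : ∀ {a b : D} (j : a ⟶ b), inclusion (F.map j) ↔ inclusion j) : IsNormalCategory C where
  inclusion_splits {a b} j hj := by
    obtain ⟨a, rfl⟩ := F.bijective_obj.2 a
    obtain ⟨b, rfl⟩ := F.bijective_obj.2 b
    obtain ⟨j, rfl⟩ := F.map_surjective j
    obtain ⟨q, hq⟩ := IsNormalCategory.inclusion_splits j ((hF j).1 hj)
    exact ⟨F.map q, by rw [← F.map_comp, hq, F.map_id]⟩
  exists_factorization {a b} f := by
    obtain ⟨a, rfl⟩ := F.bijective_obj.2 a
    obtain ⟨b, rfl⟩ := F.bijective_obj.2 b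
    obtain ⟨f, rfl⟩ := F.map_surjective f
    obtain ⟨N⟩ := IsNormalCategory.exists_factorization f
    have := N.isIso
    obtain ⟨i, hi, hiq⟩ := N.isRetraction
    exact ⟨⟨F.obj N.mid, F.obj N.im, F.map N.q, F.map N.u, F.map N.j,
      ⟨F.map i, (hF i).2 hi, by rw [← F.map_comp, hiq, F.map_id]⟩, inferInstance,
      (hF _).2 N.isInclusion, by rw [← F.map_comp, ← F.map_comp, ← N.fac]⟩⟩
  exists_cone c := by
    obtain ⟨c, rfl⟩ := F.bijective_obj.2 c
    obtain ⟨γ, rfl, hγ⟩ := IsNormalCategory.exists_cone c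
    have hobj : ∀ a : C, a = F.obj (F.objEquiv.symm a) := fun a => by simp
    let comp : ∀ a : C, a ⟶ F.obj γ.apex := fun a =>
      eqToHom (hobj a) ≫ F.map (γ.component (F.objEquiv.symm a))
    -- The equality between `a` and its preimage under `F.obj` is generalized to eliminate it.
    have hcomp : ∀ a : D, comp (F.obj a) = F.map (γ.component a) := by
      have aux : ∀ (a b : D) (h : b = a) (h' : F.obj a = F.obj b),
          eqToHom h' ≫ F.map (γ.component b) = F.map (γ.component a) := by
        rintro a _ rfl _
        simp
      exact fun a => aux a _ (by simp) _
    refine ⟨⟨F.obj γ.apex, comp, ?_, ?_⟩, rfl, ?_⟩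
    · intro a b j hj
      obtain ⟨a, rfl⟩ := F.bijective_obj.2 a
      obtain ⟨b, rfl⟩ := F.bijective_obj.2 b
      obtain ⟨j, rfl⟩ := F.map_surjective j
      rw [hcomp, hcomp, ← F.map_comp, γ.comp_component j ((hF j).1 hj)]
    · obtain ⟨m, hm⟩ := γ.exists_isIso
      exact ⟨F.obj m, by rw [hcomp]; infer_instance⟩
    · exact (hcomp γ.apex).trans (by rw [hγ, F.map_id])

/-- The inverse of an isomorphism of categories that preserves and reflects inclusions is an
isomorphism of normal categories. -/
theorem NormalCategoryIso.nonempty_of_isIso (F : D ⥤ C) [F.IsIso] [IsNormalCategory D]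
    [IsNormalCategory C] (hF : ∀ {a b : D} (j : a ⟶ b), inclusion (F.map j) ↔ inclusion j) :
    Nonempty (NormalCategoryIso C D) := by
  refine ⟨{ F.asIsomorphism.symm with
    functor_inclusion := fun {a b} j hj => ?_
    inverse_inclusion := fun j hj => (hF j).2 hj }⟩
  refine (hF (F.asIsomorphism.inverse.map j)).1 ?_
  have h := Functor.congr_hom F.asIsomorphism.counit_eq j
  change F.map (F.asIsomorphism.inverse.map j) = _ at h
  rw [h]
  exact comp_inclusion _ _ (inclusion_eqToHom _) (comp_inclusion _ _ hj (inclusion_eqToHom _))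

end Transport

/-! ### Clifford semigroups -/

section Clifford

variable {S : Type u} [Semigroup S]

theorem exists_idempotent_mul_eq [RegularSemigroup S] (x : S) :
    ∃ e : S, IsIdempotentElem e ∧ e * x = x := by
  obtain ⟨y, hy⟩ := RegularSemigroup.exists_mul_mul_eq x
  exact ⟨x * y, by rw [IsIdempotentElem, ← mul_assoc, hy], hy⟩

/-- The idempotents of a Clifford semigroup are central: if `g` is the identity of the group that
contains `ex` and `xe`, then `eg = ge = g`, hence `ex = egxg = gxg = gxge = xe`. -/
theorem idempotent_mul_comm [CliffordSemigroup S] {e : S}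
    (he : IsIdempotentElem e) (x : S) : e * x = x * e := by
  obtain ⟨Y, _, π, -, hπ, h⟩ := CliffordSemigroup.semilattice_of_groups (S := S)
  obtain ⟨g, hg, h1, h2⟩ := h (π e ⊓ π x)
  have idem : ∀ k, π k = π e ⊓ π x → k * k = k → k = g := by
    intro k hk hkk
    obtain ⟨y, -, -, hy⟩ := h2 k hk
    rw [← (h1 k hk).1, ← hy, mul_assoc, hkk]
  have peg : π (e * g) = π e ⊓ π x := by rw [hπ, hg, ← inf_assoc, inf_idem]
  have pge : π (g * e) = π e ⊓ π x := by rw [hπ, hg, inf_comm, ← inf_assoc, inf_idem]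
  have eg : e * g = g := idem _ peg (by rw [mul_assoc, (h1 _ peg).1, ← mul_assoc, he.eq])
  have ge : g * e = g := idem _ pge (by rw [← mul_assoc, (h1 _ pge).2, mul_assoc, he.eq])
  have pxg : π (x * g) = π e ⊓ π x := by rw [hπ, hg, inf_comm, inf_assoc, inf_idem]
  have pgx : π (g * x) = π e ⊓ π x := by rw [hπ, hg, inf_assoc, inf_idem]
  calc e * x = e * x * g := ((h1 _ (hπ e x)).2).symm
    _ = e * (g * (x * g)) := by rw [(h1 _ pxg).1, mul_assoc]
    _ = g * (x * g) := by rw [← mul_assoc, eg]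
    _ = (g * x) * (g * e) := by rw [ge, mul_assoc]
    _ = (g * x) * e := by rw [← mul_assoc, (h1 _ pgx).2]
    _ = x * e := by
      rw [mul_assoc, (h1 (x * e) (by rw [hπ, inf_comm])).1]

/-! ### Principal ideals and their morphisms -/

theorem mem_leftIdeal_self [RegularSemigroup S] (x : S) : x ∈ leftIdeal x := by
  obtain ⟨y, hy⟩ := RegularSemigroup.exists_mul_mul_eq x
  exact ⟨x * y, hy.symm⟩

theorem mem_rightIdeal_self [RegularSemigroup S] (x : S) : x ∈ rightIdeal x := by
  obtain ⟨y, hy⟩ := RegularSemigroup.exists_mul_mul_eq x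
  exact ⟨y * x, by rw [← mul_assoc, hy]⟩

theorem mul_mem_carrier_left (A : LeftIdealCat S) (s : S) {x : S} (hx : x ∈ A.carrier) :
    s * x ∈ A.carrier := by
  obtain ⟨e, -, hA⟩ := A.exists_idempotent
  rw [hA] at hx ⊢
  obtain ⟨t, rfl⟩ := hx
  exact ⟨s * t, (mul_assoc _ _ _).symm⟩

theorem mul_mem_carrier_right (A : RightIdealCat S) {x : S} (hx : x ∈ A.carrier) (s : S) :
    x * s ∈ A.carrier := by
  obtain ⟨e, -, hA⟩ := A.exists_idempotent
  rw [hA] at hx ⊢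
  obtain ⟨t, rfl⟩ := hx
  exact ⟨t * s, mul_assoc _ _ _⟩

/-- An idempotent generator of a principal right ideal. -/
noncomputable def RightIdealCat.idem (A : RightIdealCat S) : S := A.exists_idempotent.choose

theorem RightIdealCat.isIdempotentElem_idem (A : RightIdealCat S) : IsIdempotentElem A.idem :=
  A.exists_idempotent.choose_spec.1

theorem RightIdealCat.carrier_eq (A : RightIdealCat S) : A.carrier = rightIdeal A.idem :=
  A.exists_idempotent.choose_spec.2

theorem LeftIdealCat.Hom.exists_eq_mul {A B : LeftIdealCat S} (φ : A ⟶ B) :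
    ∃ w : S, ∀ x, (φ.toFun x : S) = x * w := by
  obtain ⟨-, w, -, -, -, -, -, -, h⟩ := φ.exists_rho
  exact ⟨w, h⟩

theorem RightIdealCat.Hom.exists_eq_mul {A B : RightIdealCat S} (φ : A ⟶ B) :
    ∃ w : S, ∀ x, (φ.toFun x : S) = w * x := by
  obtain ⟨-, w, -, -, -, -, -, -, h⟩ := φ.exists_lambda
  exact ⟨w, h⟩

/-- Right multiplication by `w`, as a morphism `A ⟶ B` of `𝕃(S)` when `Aw ⊆ B`. -/
def mulRightHom (A B : LeftIdealCat S) (w : S) (h : ∀ x ∈ A.carrier, x * w ∈ B.carrier) : A ⟶ B :=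
  LeftIdealCat.Hom.mk (fun x => ⟨x * w, h x x.2⟩) (by
    obtain ⟨e, he, hA⟩ := A.exists_idempotent
    obtain ⟨f, hf, hB⟩ := B.exists_idempotent
    have hx := mem_carrier_left he hA
    have hef : e * w * f = e * w :=
      mem_carrier_left hf hB ⟨e * w, h e (hA ▸ (mem_leftIdeal he).2 he)⟩
    refine ⟨e, e * w, f, he, hf, hA, hB, ⟨w, hef.symm⟩, fun x => ?_⟩
    rw [← mul_assoc, hx])

/-- Left multiplication by `w`, as a morphism `A ⟶ B` of `ℝ(S)` when `wA ⊆ B`. -/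
def mulLeftHom (A B : RightIdealCat S) (w : S) (h : ∀ x ∈ A.carrier, w * x ∈ B.carrier) : A ⟶ B :=
  RightIdealCat.Hom.mk (fun x => ⟨w * x, h x x.2⟩) (by
    obtain ⟨e, he, hA⟩ := A.exists_idempotent
    obtain ⟨f, hf, hB⟩ := B.exists_idempotent
    have hx := mem_carrier_right he hA
    have hef : f * (w * e) = w * e :=
      mem_carrier_right hf hB ⟨w * e, h e (hA ▸ (mem_rightIdeal he).2 he)⟩
    refine ⟨e, w * e, f, he, hf, hA, hB, ⟨w, by rw [mul_assoc, hef]⟩, fun x => ?_⟩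
    rw [mul_assoc, hx])

/-! ### Principal cones -/

theorem NormalCone.ext_left {γ δ : NormalCone (LeftIdealCat S)} (h : γ.apex = δ.apex)
    (h' : ∀ a x, ((γ.component a).toFun x : S) = (δ.component a).toFun x) : γ = δ := by
  obtain ⟨d, p, hp, hm⟩ := γ
  obtain ⟨d', p', hp', hm'⟩ := δ
  dsimp only at h
  subst h
  have : p = p' := funext fun a => LeftIdealCat.hom_ext (h' a)
  subst this
  rfl

/-- The object `Sx` of `𝕃(S)`, for an arbitrary element `x` of a regular semigroup. -/
def leftObjOf [RegularSemigroup S] (x : S) : LeftIdealCat S :=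
  ⟨leftIdeal x, by
    obtain ⟨y, hy⟩ := RegularSemigroup.exists_mul_mul_eq x
    refine ⟨y * x, by rw [IsIdempotentElem, mul_assoc, ← mul_assoc x, hy], ?_⟩
    ext z
    constructor
    · rintro ⟨s, rfl⟩
      exact ⟨s * x, by rw [mul_assoc, ← mul_assoc x, hy]⟩
    · rintro ⟨s, rfl⟩
      exact ⟨s * y, by rw [mul_assoc]⟩⟩

/-- The principal cone `ρ^x`, with apex `Sx`: all its components are right multiplication
by `x`. -/
def principalCone [RegularSemigroup S] (x : S) : NormalCone (LeftIdealCat S) where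
  apex := leftObjOf x
  component a := mulRightHom a (leftObjOf x) x fun z _ => ⟨z, rfl⟩
  comp_component j hj := LeftIdealCat.hom_ext fun z => by
    change (j.toFun z : S) * x = z * x
    rw [hj]
  exists_isIso := by
    -- If `xyx = x`, then right multiplication by `y` inverts the component at `S(xy)`.
    obtain ⟨y, hy⟩ := RegularSemigroup.exists_mul_mul_eq x
    have hxy : IsIdempotentElem (x * y) := by rw [IsIdempotentElem, ← mul_assoc, hy]
    refine ⟨leftObj _ hxy, mulRightHom (leftObjOf x) (leftObj _ hxy) y ?_,
      LeftIdealCat.hom_ext fun z => ?_, LeftIdealCat.hom_ext fun z => ?_⟩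
    · rintro _ ⟨s, rfl⟩
      exact ⟨s, mul_assoc _ _ _⟩
    · change (z : S) * x * y = z
      rw [mul_assoc, mem_carrier_left (A := leftObj _ hxy) hxy rfl z]
    · change (z : S) * y * x = z
      obtain ⟨z, s, rfl⟩ := z
      change s * x * y * x = s * x
      rw [mul_assoc, mul_assoc, ← mul_assoc x, hy]

section Star

variable [RegularSemigroup S]

theorem epiPart_toFun {A B : LeftIdealCat S} (f : A ⟶ B) (x : A.carrier) :
    ((epiPart f).toFun x : S) = f.toFun x := by
  have h : (imageInclusion f).toFun ((epiPart f).toFun x) = f.toFun x :=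
    congrArg (fun φ : A ⟶ B => φ.toFun x) (epiPart_comp f)
  rw [← h]
  exact (imageInclusion_inclusion f _).symm

theorem epiPart_surjective {A B : LeftIdealCat S} (f : A ⟶ B) :
    Function.Surjective (epiPart f).toFun := by
  intro y
  obtain ⟨i, -, hi⟩ := (factorization f).isRetraction
  have := (factorization f).isIso
  refine ⟨i.toFun ((inv (factorization f).u).toFun y), ?_⟩
  have h : inv (factorization f).u ≫ i ≫ epiPart f = 𝟙 _ := by
    rw [epiPart, reassoc_of% hi]
    simp
  exact congrArg (fun φ : image f ⟶ image f => φ.toFun y) h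

/-- `ρ^x * f° = ρ^{xf}`. -/
theorem principalCone_star (x : S) {c : LeftIdealCat S} (f : (principalCone x).apex ⟶ c) :
    (principalCone x).star (epiPart f) =
      principalCone (f.toFun ⟨x, mem_leftIdeal_self x⟩ : S) := by
  obtain ⟨w, hw⟩ := f.exists_eq_mul
  refine NormalCone.ext_left (LeftIdealCat.ext (Set.ext fun z => ?_)) fun a z => ?_
  · change z ∈ (image f).carrier ↔ z ∈ leftIdeal _
    constructor
    · intro hz
      obtain ⟨⟨_, s, rfl⟩, ht⟩ := epiPart_surjective f ⟨z, hz⟩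
      have := congrArg Subtype.val ht
      rw [epiPart_toFun, hw] at this
      refine ⟨s, ?_⟩
      rw [hw, ← mul_assoc]
      exact this.symm
    · rintro ⟨s, rfl⟩
      rw [← epiPart_toFun]
      exact mul_mem_carrier_left _ _ (Subtype.prop _)
  · change ((epiPart f).toFun _ : S) = z * _
    rw [epiPart_toFun, hw, hw, ← mul_assoc]
    rfl

theorem principalCone_mul (x y : S) :
    principalCone x * principalCone y = principalCone (x * y) :=
  principalCone_star x _

theorem mem_hSet_principalCone {e : S} (he : IsIdempotentElem e) (c : LeftIdealCat S)
    {δ : NormalCone (LeftIdealCat S)} :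
    δ ∈ hSet (principalCone e) c ↔ ∃ u ∈ rightIdeal e, u ∈ c.carrier ∧ δ = principalCone u := by
  constructor
  · rintro ⟨f, rfl⟩
    obtain ⟨w, hw⟩ := f.exists_eq_mul
    exact ⟨_, ⟨w, hw _⟩, (f.toFun ⟨e, mem_leftIdeal_self e⟩).2, principalCone_star e f⟩
  · rintro ⟨u, hu, hc, rfl⟩
    refine ⟨mulRightHom _ c u fun z _ => mul_mem_carrier_left c z hc, ?_⟩
    rw [principalCone_star]
    exact congrArg principalCone ((mem_rightIdeal he).1 hu).symm

/-- `H(ρ^e; g)` sends `ρ^u` to `ρ^{ug}`. -/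
theorem hMap_principalCone {e : S} {c d : LeftIdealCat S}
    (g : c ⟶ d) (δ : hSet (principalCone e) c) (hinj : Function.Injective (principalCone (S := S)))
    {u : S} (hu : u ∈ c.carrier) (h : δ.1 = principalCone u) :
    (hMap (principalCone e) g δ).1 = principalCone (g.toFun ⟨u, hu⟩ : S) := by
  obtain ⟨_, f, rfl⟩ := δ
  rw [hMap_star]
  refine (principalCone_star e (f ≫ g)).trans ?_
  replace h := (principalCone_star e f).symm.trans h
  have : f.toFun ⟨e, mem_leftIdeal_self e⟩ = ⟨u, hu⟩ := Subtype.ext (hinj h)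
  rw [← this]
  rfl

end Star

/-! ### The normal cones of a Clifford semigroup -/

variable [CliffordSemigroup S]

theorem LeftIdealCat.Hom.toFun_mem_domain {A B : LeftIdealCat S} (φ : A ⟶ B) (x : A.carrier) :
    (φ.toFun x : S) ∈ A.carrier := by
  obtain ⟨e, he, hA⟩ := A.exists_idempotent
  obtain ⟨w, hw⟩ := φ.exists_eq_mul
  have hx := mem_carrier_left he hA x
  have h : (x : S) * w ∈ leftIdeal e :=
    ⟨x * w, by rw [mul_assoc, ← idempotent_mul_comm he, ← mul_assoc, hx]⟩
  rw [hw]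
  exact hA.symm.subset h

theorem LeftIdealCat.eq_of_isIso {A B : LeftIdealCat S} (φ : A ⟶ B) [IsIso φ] : A = B := by
  have key : ∀ {A B : LeftIdealCat S} (φ : A ⟶ B) [IsIso φ], A.carrier ⊆ B.carrier := by
    intro A B φ _ x hx
    have h : (inv φ).toFun (φ.toFun ⟨x, hx⟩) = ⟨x, hx⟩ :=
      congrArg (fun ψ : A ⟶ A => ψ.toFun ⟨x, hx⟩) (IsIso.hom_inv_id φ)
    have := (inv φ).toFun_mem_domain (φ.toFun ⟨x, hx⟩)
    rwa [h] at this
  exact LeftIdealCat.ext ((key φ).antisymm (key (inv φ)))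

theorem principalCone_injective : Function.Injective (principalCone (S := S)) := by
  intro x y h
  obtain ⟨e, he, hex⟩ := exists_idempotent_mul_eq x
  have hcar : leftIdeal x = leftIdeal y :=
    congrArg (fun γ : NormalCone (LeftIdealCat S) => γ.apex.carrier) h
  have hey : e * y = y := by
    have hy : y ∈ leftIdeal x := hcar ▸ mem_leftIdeal_self y
    obtain ⟨s, rfl⟩ := hy
    rw [← mul_assoc, idempotent_mul_comm he, mul_assoc, hex]
  have hval : ∀ γ δ : NormalCone (LeftIdealCat S), γ = δ → ∀ a z,
      ((γ.component a).toFun z : S) = (δ.component a).toFun z := by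
    rintro γ _ rfl a z
    rfl
  have : e * x = e * y := hval _ _ h (leftObj e he) ⟨e, mem_leftIdeal_self e⟩
  rwa [hex, hey] at this

/-- Over a Clifford semigroup every normal cone is principal. An invertible component of `γ` is
necessarily the one at the apex `Se`; with `u = γ(Se)(e)`, compatibility with the
inclusions of `a ∩ Se` in `a` and in `Se` gives `γ = ρ^u`. -/
theorem principalCone_surjective : Function.Surjective (principalCone (S := S)) := by
  intro γ
  obtain ⟨m, hm⟩ := γ.exists_isIso
  obtain rfl : m = γ.apex := LeftIdealCat.eq_of_isIso (γ.component m)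
  obtain ⟨e, he, hA⟩ := γ.apex.exists_idempotent
  have hmul := mem_carrier_left he hA
  have hee : e ∈ γ.apex.carrier := hA ▸ mem_leftIdeal_self e
  obtain ⟨w, hw⟩ := (γ.component γ.apex).exists_eq_mul
  have hud : e * w ∈ γ.apex.carrier := by
    have := ((γ.component γ.apex).toFun ⟨e, hee⟩).2
    rwa [hw] at this
  refine ⟨e * w, NormalCone.ext_left (LeftIdealCat.ext (Set.ext fun z => ?_)) fun a x => ?_⟩
  · change z ∈ leftIdeal (e * w) ↔ _
    constructor
    · rintro ⟨s, rfl⟩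
      exact mul_mem_carrier_left _ _ hud
    · intro hz
      refine ⟨(inv (γ.component γ.apex)).toFun ⟨z, hz⟩, ?_⟩
      have h : (γ.component γ.apex).toFun ((inv (γ.component γ.apex)).toFun ⟨z, hz⟩) = ⟨z, hz⟩ :=
        congrArg (fun ψ : γ.apex ⟶ γ.apex => ψ.toFun ⟨z, hz⟩)
          (IsIso.inv_hom_id (γ.component γ.apex))
      rw [← mul_assoc, hmul, ← hw, h]
  · change (x : S) * (e * w) = (γ.component a).toFun x
    obtain ⟨f, hf, ha⟩ := a.exists_idempotent
    have hx := mem_carrier_left hf ha x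
    -- With `a = Sf`, the object `b = S(fe)` is the intersection of `a` and the apex.
    have hef : IsIdempotentElem (f * e) := by
      rw [IsIdempotentElem, mul_assoc, ← mul_assoc e, idempotent_mul_comm he f, mul_assoc, he.eq,
        ← mul_assoc, hf.eq]
    let b := leftObj (f * e) hef
    have hba : ∀ z ∈ b.carrier, z ∈ a.carrier := by
      rintro _ ⟨s, rfl⟩
      rw [ha]
      exact ⟨s * e, by rw [idempotent_mul_comm hf e, mul_assoc]⟩
    have hbd : ∀ z ∈ b.carrier, z ∈ γ.apex.carrier := by
      rintro _ ⟨s, rfl⟩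
      rw [hA]
      exact ⟨s * f, by rw [mul_assoc]⟩
    have hb : ∀ z ∈ b.carrier, z * (f * e) = z := fun z => (mem_leftIdeal hef).1
    have hxe : (x : S) * e ∈ b.carrier := ⟨x, by rw [← mul_assoc, hx]⟩
    let i : b ⟶ a := mulRightHom b a (f * e) fun z hz => by rw [hb z hz]; exact hba z hz
    let j : b ⟶ γ.apex := mulRightHom b γ.apex (f * e) fun z hz => by
      rw [hb z hz]; exact hbd z hz
    have hi := γ.comp_component i fun z => hb z z.2
    have hj := γ.comp_component j fun z => hb z z.2
    obtain ⟨v, hv⟩ := (γ.component a).exists_eq_mul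
    have hij : ((i ≫ γ.component a).toFun ⟨x * e, hxe⟩ : S) =
        (j ≫ γ.component γ.apex).toFun ⟨x * e, hxe⟩ := by rw [hi, hj]
    have hij' : (x : S) * e * (f * e) * v = x * e * (f * e) * w := by
      rw [← hv ⟨x * e * (f * e), _⟩, ← hw ⟨x * e * (f * e), _⟩]
      exact hij
    rw [hb _ hxe] at hij'
    rw [← mul_assoc, ← hij', mul_assoc, idempotent_mul_comm he, ← mul_assoc, ← hv, hmul]

/-- Over a Clifford semigroup, `x ↦ ρ^x` is a bijection from the semigroup onto the normal cones
of `𝕃(S)`. -/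
noncomputable def coneEquiv : S ≃ NormalCone (LeftIdealCat S) :=
  Equiv.ofBijective principalCone ⟨principalCone_injective, principalCone_surjective⟩

/-- The element `x` with `γ = ρ^x`. -/
noncomputable def coneElt (γ : NormalCone (LeftIdealCat S)) : S := coneEquiv.symm γ

@[simp]
theorem principalCone_coneElt (γ : NormalCone (LeftIdealCat S)) : principalCone (coneElt γ) = γ :=
  coneEquiv.apply_symm_apply γ

@[simp]
theorem coneElt_principalCone (x : S) : coneElt (principalCone x) = x :=
  coneEquiv.symm_apply_apply x

theorem coneElt_mem {e : S} (he : IsIdempotentElem e) {c : LeftIdealCat S}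
    {δ : NormalCone (LeftIdealCat S)} (hδ : δ ∈ hSet (principalCone e) c) :
    coneElt δ ∈ rightIdeal e ∧ coneElt δ ∈ c.carrier := by
  obtain ⟨u, hu, hc, rfl⟩ := (mem_hSet_principalCone he c).1 hδ
  rw [coneElt_principalCone]
  exact ⟨hu, hc⟩

/-! ### The isomorphism from `ℝ(S)` to the normal dual of `𝕃(S)` -/

theorem rightObj_idem (e : S) (he : IsIdempotentElem e) : (rightObj e he).idem = e := by
  set f := (rightObj e he).idem
  have hf : IsIdempotentElem f := (rightObj e he).isIdempotentElem_idem
  have h : rightIdeal e = rightIdeal f := (rightObj e he).carrier_eq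
  have h1 : f * e = e := (mem_rightIdeal hf).1 (h ▸ mem_rightIdeal_self e)
  have h2 : e * f = f := (mem_rightIdeal he).1 (h ▸ mem_rightIdeal_self f)
  rw [← h2, idempotent_mul_comm he, h1]

theorem coneElt_mem_left {A : RightIdealCat S} {c : LeftIdealCat S}
    (δ : hSet (principalCone A.idem) c) : coneElt δ.1 ∈ c.carrier :=
  (coneElt_mem A.isIdempotentElem_idem δ.2).2

theorem coneElt_mem_right {A : RightIdealCat S} {c : LeftIdealCat S}
    (δ : hSet (principalCone A.idem) c) : coneElt δ.1 ∈ A.carrier :=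
  A.carrier_eq ▸ (coneElt_mem A.isIdempotentElem_idem δ.2).1

theorem principalCone_mem_hSet {A : RightIdealCat S} {c : LeftIdealCat S} {u : S}
    (hA : u ∈ A.carrier) (hc : u ∈ c.carrier) : principalCone u ∈ hSet (principalCone A.idem) c :=
  (mem_hSet_principalCone A.isIdempotentElem_idem c).2 ⟨u, A.carrier_eq ▸ hA, hc, rfl⟩

theorem hMap_val {A : RightIdealCat S} {c d : LeftIdealCat S} (g : c ⟶ d)
    (δ : hSet (principalCone A.idem) c) : (hMap (principalCone A.idem) g δ).1 =
      principalCone (g.toFun ⟨coneElt δ.1, coneElt_mem_left δ⟩ : S) :=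
  hMap_principalCone g δ principalCone_injective _ (principalCone_coneElt _).symm

/-- The map `H(A; c) → H(B; c)` induced by `φ : A ⟶ B`: it sends `ρ^u` to `ρ^{φ(u)}`. -/
noncomputable def dualApp {A B : RightIdealCat S} (φ : A ⟶ B) (c : LeftIdealCat S)
    (δ : hSet (principalCone A.idem) c) : hSet (principalCone B.idem) c :=
  ⟨principalCone (φ.toFun ⟨coneElt δ.1, coneElt_mem_right δ⟩ : S),
    principalCone_mem_hSet (Subtype.prop _) (by
      obtain ⟨w, hw⟩ := φ.exists_eq_mul
      rw [hw]
      exact mul_mem_carrier_left c w (coneElt_mem_left δ))⟩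

theorem dualApp_naturality {A B : RightIdealCat S} (φ : A ⟶ B) {c d : LeftIdealCat S} (g : c ⟶ d)
    (δ : hSet (principalCone A.idem) c) :
    dualApp φ d (hMap _ g δ) = hMap _ g (dualApp φ c δ) := by
  apply Subtype.ext
  obtain ⟨w, hw⟩ := φ.exists_eq_mul
  obtain ⟨v, hv⟩ := g.exists_eq_mul
  rw [hMap_val]
  simp only [dualApp, hw, hv, hMap_val, coneElt_principalCone, mul_assoc]

/-- The functor `ℝ(S) ⥤ N*𝕃(S)` which sends `eS` to `H(ρ^e; -)` and `φ : eS ⟶ fS` to the natural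
transformation `ρ^u ↦ ρ^{φ(u)}`. -/
noncomputable def dualFunctor (S : Type u) [Semigroup S] [CliffordSemigroup S] :
    RightIdealCat S ⥤ NormalDual (LeftIdealCat S) where
  obj A := ⟨hFunctor (principalCone A.idem), principalCone A.idem, by
    rw [principalCone_mul, A.isIdempotentElem_idem.eq], rfl⟩
  map φ := ObjectProperty.homMk
    { app := fun c => dualApp φ c
      naturality := fun _ _ g => funext fun δ => dualApp_naturality φ g δ }
  map_id A := by
    apply ObjectProperty.hom_ext
    ext c
    funext δ
    exact Subtype.ext (principalCone_coneElt δ.1)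
  map_comp φ ψ := by
    apply ObjectProperty.hom_ext
    ext c
    funext δ
    apply Subtype.ext
    change principalCone _ = principalCone (ψ.toFun ⟨coneElt (principalCone _), _⟩ : S)
    simp only [coneElt_principalCone]
    rfl

theorem dualApp_principalCone {A B : RightIdealCat S} (φ : A ⟶ B) (x : A.carrier) :
    (dualApp φ (leftObjOf (x : S))
      ⟨principalCone (x : S), principalCone_mem_hSet x.2 (mem_leftIdeal_self _)⟩).1 =
      principalCone (φ.toFun x : S) := by
  simp only [dualApp, coneElt_principalCone]

theorem dualFunctor_inclusion {A B : RightIdealCat S} (φ : A ⟶ B) :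
    inclusion ((dualFunctor S).map φ) ↔ inclusion φ := by
  constructor
  · intro h x
    exact principalCone_injective ((dualApp_principalCone φ x).symm.trans
      (h (leftObjOf (x : S))
        ⟨principalCone (x : S), principalCone_mem_hSet x.2 (mem_leftIdeal_self _)⟩))
  · intro h c δ
    exact (congrArg principalCone (h _)).trans (principalCone_coneElt δ.1)

instance : (dualFunctor S).Faithful where
  map_injective {A B} φ ψ h := RightIdealCat.hom_ext fun x => by
    have e : dualApp φ (leftObjOf (x : S)) = dualApp ψ (leftObjOf (x : S)) :=
      congrArg (fun τ : (dualFunctor S).obj A ⟶ (dualFunctor S).obj B => τ.hom.app _) h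
    apply principalCone_injective
    rw [← dualApp_principalCone φ, ← dualApp_principalCone ψ, e]

/-- Fullness is the Yoneda argument: a natural transformation `H(ρ^e; -) ⟶ H(ρ^f; -)` is determined
by the image `ρ^w` of `ρ^e ∈ H(ρ^e; Se)`, and it is induced by left multiplication by `w`. -/
instance : (dualFunctor S).Full where
  map_surjective {A B} τ := by
    let e := A.idem
    have he : IsIdempotentElem e := A.isIdempotentElem_idem
    let app : ∀ c, hSet (principalCone A.idem) c → hSet (principalCone B.idem) c :=
      fun c => τ.hom.app c
    have hnat : ∀ {c d : LeftIdealCat S} (g : c ⟶ d) δ, app d (hMap _ g δ) = hMap _ g (app c δ) :=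
      fun g δ => congrFun (τ.hom.naturality g) δ
    let δ₀ : hSet (principalCone A.idem) (leftObj e he) := ⟨principalCone e,
      principalCone_mem_hSet (A.carrier_eq ▸ mem_rightIdeal_self _) (mem_leftIdeal_self e)⟩
    let w := coneElt (app _ δ₀).1
    have hw : ∀ u, w * u ∈ B.carrier := mul_mem_carrier_right B (coneElt_mem_right (app _ δ₀))
    refine ⟨mulLeftHom A B w fun u _ => hw u, ?_⟩
    apply ObjectProperty.hom_ext
    ext c
    funext δ
    apply Subtype.ext
    change principalCone (w * coneElt δ.1) = (app c δ).1
    let g : leftObj e he ⟶ c := mulRightHom _ c (coneElt δ.1) fun z _ =>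
      mul_mem_carrier_left c z (coneElt_mem_left δ)
    have hδ : hMap _ g δ₀ = δ := by
      apply Subtype.ext
      rw [hMap_val]
      change principalCone (coneElt (principalCone e) * coneElt δ.1) = δ.1
      have := coneElt_mem_right δ
      rw [A.carrier_eq] at this
      rw [coneElt_principalCone, (mem_rightIdeal he).1 this, principalCone_coneElt]
    have h := (congrArg Subtype.val (hnat g δ₀)).trans (hMap_val g _)
    rw [hδ] at h
    exact h.symm

theorem dualFunctor_obj_injective : Function.Injective (dualFunctor S).obj := by
  have key : ∀ A B : RightIdealCat S, (dualFunctor S).obj A = (dualFunctor S).obj B →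
      A.carrier ⊆ B.carrier := by
    intro A B h x hx
    have hset : hSet (principalCone A.idem) (leftObjOf x) =
        hSet (principalCone B.idem) (leftObjOf x) :=
      congrArg (fun X : NormalDual (LeftIdealCat S) => (X.obj.obj (leftObjOf x)).carrier) h
    have hm := principalCone_mem_hSet (c := leftObjOf x) hx (mem_leftIdeal_self x)
    rw [hset] at hm
    simpa using coneElt_mem_right ⟨_, hm⟩
  exact fun A B h => RightIdealCat.ext ((key A B h).antisymm (key B A h.symm))

theorem dualFunctor_obj_surjective : Function.Surjective (dualFunctor S).obj := by
  rintro ⟨_, ε, hε, rfl⟩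
  obtain ⟨e, rfl⟩ := principalCone_surjective ε
  have he : IsIdempotentElem e := by
    rw [principalCone_mul] at hε
    exact principalCone_injective hε
  refine ⟨rightObj e he, ObjectProperty.FullSubcategory.ext ?_⟩
  change hFunctor (principalCone (rightObj e he).idem) = _
  rw [rightObj_idem]

instance : (dualFunctor S).IsIso where
  bijective_obj := ⟨dualFunctor_obj_injective, dualFunctor_obj_surjective⟩

end Clifford

end CrossConnection

theorem mainTheorem3 (S : Type u) [Semigroup S] [CrossConnection.CliffordSemigroup S] :
    ∃ _ : CrossConnection.IsNormalCategory
        (CrossConnection.NormalDual (CrossConnection.LeftIdealCat S)),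
      Nonempty (CrossConnection.NormalCategoryIso
        (CrossConnection.NormalDual (CrossConnection.LeftIdealCat S))
        (CrossConnection.RightIdealCat S)) := by
  have h := CrossConnection.IsNormalCategory.of_isIso (CrossConnection.dualFunctor S)
    CrossConnection.dualFunctor_inclusion
  exact ⟨h, CrossConnection.NormalCategoryIso.nonempty_of_isIso (CrossConnection.dualFunctor S)
    CrossConnection.dualFunctor_inclusion⟩
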